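/- Let $d\ge 0$ be an integer, let $X_d$ denote either the space $C(\mathbb{R}^d)$ of continuous complex-valued functions on $\mathbb{R}^d$ or the space $\mathcal{D}'(\mathbb{R}^d)$ of complex-valued Schwartz distributions on $\mathbb{R}^d$. For $y,h\in\mathbb{R}^d$ and $m\in\mathbb{N}$, let $(\tau_yf)(x)=f(x+y)$ and $\Delta_h^mf=\sum_{k=0}^m\binom{m}{k}(-1)^{m-k}\tau_{kh}f$ for functions $f$, and let $(\tau_yT)\{\varphi\}=T\{\tau_{-y}\varphi\}$ and $(\Delta_h^mT)\{\varphi\}=T\{\Delta_{-h}^m\varphi\}$ for distributions $T$ and test functions $\varphi$. A continuous exponential polynomial on $\mathbb{R}^d$ is a function of the form $f(x)=\sum_{i=1}^n p_i(x)e^{\langle\lambda_i,x\rangle}$ with complex polynomials $p_i$ in $d$ variables and $\lambda_i\in\mathbb{C}^d$, where $\langle\lambda,x\rangle=\sum_j\lambda_jx_j$; a distribution is called a continuous exponential polynomial if it is of the form $\varphi\mapsto\int_{\mathbb{R}^d}\varphi f\,dx$ for such an $f$. Let $h_1,\dots,h_t\in\mathbb{R}^d$ be such that the subgroup $h_1\mathbb{Z}+\cdots+h_t\mathbb{Z}$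 is dense in $\mathbb{R}^d$, let $m_1,\dots,m_t$ be positive integers, and let $W$ and $H$ be finite-dimensional complex linear subspaces of $X_d$ such that $$\Delta_{h_k}^{m_k}(W)\subseteq H\quad\text{and}\quad \Delta_{h_k}^{m_k}(H)\subseteq H\qquad (k=1,\dots,t).$$ Then there exists a finite-dimensional subspace $Z$ of $X_d$ which is invariant under all translations ($\tau_y(Z)\subseteq Z$ for every $y\in\mathbb{R}^d$) and contains $W\cup H$. Consequently, every element of $W\cup H$ is a continuous exponential polynomial. -/

import Mathlib

open TopologicalSpace MeasureTheory
open scoped Distributions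

noncomputable section

/-- The Euclidean space `ℝ^d`. -/
abbrev Euc (d : ℕ) : Type := EuclideanSpace ℝ (Fin d)

/-- Real-valued smooth compactly supported test functions on `ℝ^d`, with the LF topology. -/
abbrev TestFun (d : ℕ) : Type := 𝓓((⊤ : Opens (Euc d)), ℝ)

/-- Complex-valued Schwartz distributions on `ℝ^d`. Mathlib tests distributions against real-valued
test functions; a complex-linear functional on complex test functions is determined by these. -/
abbrev Distr (d : ℕ) : Type := 𝓓'((⊤ : Opens (Euc d)), ℂ)

/-! ### Translations and forward differences of continuous functions -/

/-- The translation operator `(τ_y f)(x) = f (x + y)` on `C(ℝ^d)`. -/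
def translateFun {d : ℕ} (y : Euc d) : C(Euc d, ℂ) →ₗ[ℂ] C(Euc d, ℂ) where
  toFun f := ⟨fun x => f (x + y), by fun_prop⟩
  map_add' _ _ := rfl
  map_smul' _ _ := rfl

/-- The forward difference `Δ_h^m f = ∑_{k=0}^m (m choose k) (-1)^(m-k) τ_{kh} f` on `C(ℝ^d)`. -/
def diffFun {d : ℕ} (h : Euc d) (m : ℕ) : C(Euc d, ℂ) →ₗ[ℂ] C(Euc d, ℂ) :=
  ∑ k ∈ Finset.range (m + 1), ((m.choose k : ℂ) * (-1) ^ (m - k)) • translateFun (k • h)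

/-! ### Translations and forward differences of test functions -/

/-- The compact set `K - y`. -/
def shiftCompact {d : ℕ} (y : Euc d) (K : Compacts (Euc d)) : Compacts (Euc d) :=
  K.map (fun x => x - y) (by fun_prop)

theorem mem_shiftCompact {d : ℕ} {y : Euc d} {K : Compacts (Euc d)} {x : Euc d} :
    x ∈ shiftCompact y K ↔ x + y ∈ K := by
  rw [← SetLike.mem_coe, ← SetLike.mem_coe, shiftCompact, Compacts.coe_map]
  constructor
  · rintro ⟨z, hz, rfl⟩
    simpa using hz
  · intro hx
    exact ⟨x + y, hx, by simp⟩

/-- Translation by `y`, as a continuous linear map from the smooth functions supported in `K`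
to the smooth functions supported in `K - y`. -/
def translateSupportedIn {d : ℕ} (y : Euc d) (K : Compacts (Euc d)) :
    ContDiffMapSupportedIn (Euc d) ℝ ⊤ K →L[ℝ]
      ContDiffMapSupportedIn (Euc d) ℝ ⊤ (shiftCompact y K) :=
  ContDiffMapSupportedIn.mkCLM ℝ (fun f x => f (x + y))
    (fun _ _ _ => rfl) (fun _ _ _ => rfl)
    (fun f => f.contDiff.comp (contDiff_id.add contDiff_const))
    (fun f x hx => f.zero_on_compl (fun hxy => hx (mem_shiftCompact.2 hxy)))
    (fun i hi => ⟨{i}, 1, zero_le_one, fun f x _ => by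
      rw [iteratedFDeriv_comp_add_right, one_mul, Finset.sup_singleton]
      exact ContDiffMapSupportedIn.norm_iteratedFDeriv_apply_le_seminorm ℝ hi⟩)

/-- The translation operator `(τ_y φ)(x) = φ (x + y)` on test functions. -/
def translateTest {d : ℕ} (y : Euc d) : TestFun d →L[ℝ] TestFun d :=
  TestFunction.limitCLM ℝ
    (fun φ => ⟨fun x => φ (x + y), φ.contDiff.comp (contDiff_id.add contDiff_const),
      φ.hasCompactSupport.comp_homeomorph (Homeomorph.addRight y), fun _ _ => trivial⟩)
    (fun K _ => (TestFunction.ofSupportedInCLM ℝ (Ω := ⊤) (fun _ _ => trivial)).comp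
      (translateSupportedIn y K))
    (fun _ _ _ => rfl)

theorem translateTest_apply {d : ℕ} (y : Euc d) (φ : TestFun d) (x : Euc d) :
    translateTest y φ x = φ (x + y) := rfl

/-- The forward difference `Δ_h^m φ = ∑_{k=0}^m (m choose k) (-1)^(m-k) τ_{kh} φ`
on test functions. -/
def diffTest {d : ℕ} (h : Euc d) (m : ℕ) : TestFun d →L[ℝ] TestFun d :=
  ∑ k ∈ Finset.range (m + 1), ((m.choose k : ℝ) * (-1) ^ (m - k)) • translateTest (k • h)

/-! ### Translations and forward differences of distributions -/

/-- The transpose `T ↦ T ∘ A` of a continuous linear operator `A` on test functions. -/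
def transposeDistr {d : ℕ} (A : TestFun d →L[ℝ] TestFun d) : Distr d →ₗ[ℂ] Distr d where
  toFun T := A.precompCompactConvergenceCLM ℂ T
  map_add' _ _ := rfl
  map_smul' _ _ := rfl

theorem transposeDistr_apply {d : ℕ} (A : TestFun d →L[ℝ] TestFun d) (T : Distr d)
    (φ : TestFun d) : transposeDistr A T φ = T (A φ) := rfl

/-- The translation operator `(τ_y T){φ} = T{τ_{-y} φ}` on distributions. -/
def translateDistr {d : ℕ} (y : Euc d) : Distr d →ₗ[ℂ] Distr d :=
  transposeDistr (translateTest (-y))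

/-- The forward difference `(Δ_h^m T){φ} = T{Δ_{-h}^m φ}` on distributions. -/
def diffDistr {d : ℕ} (h : Euc d) (m : ℕ) : Distr d →ₗ[ℂ] Distr d :=
  transposeDistr (diffTest (-h) m)

/-! ### Exponential polynomials -/

/-- `f` is a continuous exponential polynomial on `ℝ^d`: a finite sum
`f(x) = ∑ i, p_i(x) exp(⟨λ_i, x⟩)` with complex polynomials `p_i` in `d` variables, `λ_i ∈ ℂ^d`
and `⟨λ, x⟩ = ∑ j, λ_j x_j`. -/
def IsExpPoly {d : ℕ} (f : Euc d → ℂ) : Prop :=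
  ∃ (n : ℕ) (p : Fin n → MvPolynomial (Fin d) ℂ) (l : Fin n → Fin d → ℂ),
    ∀ x : Euc d, f x = ∑ i, MvPolynomial.eval (fun j => (x j : ℂ)) (p i) *
      Complex.exp (∑ j, l i j * (x j : ℂ))

/-- The distribution `T` is a continuous exponential polynomial: it is given by integration
against such a function. -/
def IsExpPolyDistr {d : ℕ} (T : Distr d) : Prop :=
  ∃ f : Euc d → ℂ, IsExpPoly f ∧ ∀ φ : TestFun d, T φ = ∫ x, (φ x : ℂ) * f x

end

/-!
Put `τ_h` for the translation by `h`. Since `Δ_h^m = (τ_h - 1)^m` and translations commute, adding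
to `W + H` its images under finitely many powers of `τ_{h_k} - 1`, for one `k` after the other,
gives a finite-dimensional space `Z` invariant under every `τ_{h_k}`. An injective operator maps
such a space onto itself, hence `Z` is invariant under the inverse translations too, so under the
group generated by the `h_k`, and by density under all translations, because orbit maps are
continuous and finite-dimensional subspaces are closed.

On `Z` the translations act by a continuous homomorphism from `ℝ^d` to matrices, which is a product
of one-parameter groups `exp (y_j b_j)`; splitting into generalized eigenspaces of the `b_j` shows
that its coefficients are exponential polynomials. A function `f ∈ Z` is itself such a coefficient,
namely `y ↦ (τ_y f)(0)`. A distribution `T ∈ Z` is regularized: for every test function `φ`, the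
integral `∫ φ(z) τ_z T dz` exists in `Z`, and by commutativity of convolution it is given by the
function `z ↦ T{τ_{-z} φ}`. These regularizations span a subspace that contains `T`, since a linear
functional on `Z` that vanishes on all of them vanishes on the orbit of `T`.
-/

noncomputable section

/-! ### Subspaces invariant under commuting operators -/

section Invariant

variable {R M ι : Type*} [Semiring R] [AddCommMonoid M] [Module R M]

theorem le_iSup_map_pow (S : Module.End R M) {m : ℕ} (hm : 0 < m) (V : Submodule R M) :
    V ≤ ⨆ i : Fin m, V.map (S ^ (i : ℕ)) :=
  le_iSup_of_le ⟨0, hm⟩ (by rw [pow_zero, Module.End.one_eq_id, Submodule.map_id])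

theorem map_iSup_map_pow_le_of_map_pow_le {S : Module.End R M} {m : ℕ} (hm : 0 < m)
    {V : Submodule R M} (hV : V.map (S ^ m) ≤ V) :
    (⨆ i : Fin m, V.map (S ^ (i : ℕ))).map S ≤ ⨆ i : Fin m, V.map (S ^ (i : ℕ)) := by
  rw [Submodule.map_iSup]
  refine iSup_le fun i => ?_
  rw [← Submodule.map_comp, ← Module.End.mul_eq_comp, ← pow_succ']
  rcases Nat.lt_or_ge (i + 1) m with hi | hi
  · exact le_iSup_of_le ⟨i + 1, hi⟩ le_rfl
  · rw [le_antisymm i.2 hi]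
    exact hV.trans (le_iSup_map_pow S hm V)

theorem map_iSup_map_pow_le_of_commute {S T : Module.End R M} (hTS : Commute T S) (m : ℕ)
    {V : Submodule R M} (hV : V.map T ≤ V) :
    (⨆ i : Fin m, V.map (S ^ (i : ℕ))).map T ≤ ⨆ i : Fin m, V.map (S ^ (i : ℕ)) := by
  rw [Submodule.map_iSup]
  refine iSup_mono fun i => ?_
  rw [← Submodule.map_comp, ← Module.End.mul_eq_comp, (hTS.pow_right _).eq,
    Module.End.mul_eq_comp, Submodule.map_comp]
  exact Submodule.map_mono hV

theorem exists_fg_map_le_of_map_pow_le [Finite ι] {S : ι → Module.End R M}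
    (hS : ∀ k l, Commute (S k) (S l)) {m : ι → ℕ} (hm : ∀ k, 0 < m k) {V : Submodule R M}
    (hfg : V.FG) (hV : ∀ k, V.map (S k ^ m k) ≤ V) :
    ∃ V' : Submodule R M, V'.FG ∧ V ≤ V' ∧ ∀ k, V'.map (S k) ≤ V' := by
  classical
  have := Fintype.ofFinite ι
  suffices h : ∀ s : Finset ι, ∃ V' : Submodule R M, V'.FG ∧ V ≤ V' ∧
      (∀ k, V'.map (S k ^ m k) ≤ V') ∧ ∀ k ∈ s, V'.map (S k) ≤ V' by
    obtain ⟨V', hfg', hVV', -, hinv⟩ := h Finset.univ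
    exact ⟨V', hfg', hVV', fun k => hinv k (Finset.mem_univ k)⟩
  intro s
  induction s using Finset.induction_on with
  | empty => exact ⟨V, hfg, le_rfl, hV, by simp⟩
  | insert a s _ ih =>
    obtain ⟨V', hfg', hVV', hpow, hinv⟩ := ih
    refine ⟨⨆ i : Fin (m a), V'.map (S a ^ (i : ℕ)), Submodule.fg_iSup _ fun i => hfg'.map _,
      hVV'.trans (le_iSup_map_pow _ (hm a) V'),
      fun k => map_iSup_map_pow_le_of_commute ((hS k a).pow_left _) _ (hpow k), fun k hk => ?_⟩
    rcases Finset.mem_insert.1 hk with rfl | hk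
    · exact map_iSup_map_pow_le_of_map_pow_le (hm _) (hpow _)
    · exact map_iSup_map_pow_le_of_commute (hS k a) _ (hinv k hk)

end Invariant

/-! ### Actions of an additive group by linear operators -/

section Action

variable {E : Type*} [AddCommGroup E]

theorem sum_choose_smul_addChar_nsmul {K A : Type*} [CommRing K] [Ring A] [Algebra K A]
    (τ : AddChar E A) (h : E) (m : ℕ) :
    ∑ k ∈ Finset.range (m + 1), ((m.choose k : K) * (-1) ^ (m - k)) • τ (k • h) =
      (τ h - 1) ^ m := by
  rw [sub_eq_add_neg, (Commute.neg_one_right (τ h)).add_pow]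
  refine Finset.sum_congr rfl fun k _ => ?_
  have hcoeff : (-1 : A) ^ (m - k) * (m.choose k : A) =
      algebraMap K A ((m.choose k : K) * (-1) ^ (m - k)) := by
    rw [map_mul, map_pow, map_neg, map_one, map_natCast]
    exact (Nat.cast_commute _ _).symm
  rw [τ.map_nsmul_eq_pow, mul_assoc, hcoeff, ← Algebra.commutes, ← Algebra.smul_def]

variable {𝕜 X : Type*} [Field 𝕜] [AddCommGroup X] [Module 𝕜 X] (τ : AddChar E (Module.End 𝕜 X))

theorem addChar_neg_apply_apply_self (a : E) (x : X) : τ (-a) (τ a x) = x := by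
  rw [← Module.End.mul_apply, ← τ.map_add_eq_mul, neg_add_cancel, τ.map_zero_eq_one,
    Module.End.one_apply]

variable {τ} {Z : Submodule 𝕜 X} [FiniteDimensional 𝕜 Z]

theorem map_addChar_eq_of_map_le {a : E} (h : Z.map (τ a) ≤ Z) : Z.map (τ a) = Z :=
  have hinj : Function.Injective (τ a) :=
    Function.LeftInverse.injective (addChar_neg_apply_apply_self τ a)
  Submodule.eq_of_le_of_finrank_eq h (Z.equivMapOfInjective (τ a) hinj).finrank_eq.symm

theorem map_addChar_eq_of_mem_closure {s : Set E} (h : ∀ a ∈ s, Z.map (τ a) ≤ Z) {y : E}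
    (hy : y ∈ AddSubgroup.closure s) : Z.map (τ y) = Z := by
  have hzero : Z.map (τ 0) = Z := by
    rw [τ.map_zero_eq_one, Module.End.one_eq_id, Submodule.map_id]
  have hadd (a b : E) : Z.map (τ (a + b)) = (Z.map (τ b)).map (τ a) := by
    rw [τ.map_add_eq_mul, Module.End.mul_eq_comp, Submodule.map_comp]
  induction hy using AddSubgroup.closure_induction with
  | mem a ha => exact map_addChar_eq_of_map_le (h a ha)
  | zero => exact hzero
  | add a b _ _ ha hb => rw [hadd, hb, ha]
  | neg a _ ha => conv_lhs => rw [← ha, ← hadd, neg_add_cancel, hzero]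

end Action

section WeaklyContinuousAction

variable {E : Type*} [AddCommGroup E] [TopologicalSpace E] {𝕜 X Y : Type*}
  [NontriviallyNormedField 𝕜] [CompleteSpace 𝕜] [AddCommGroup X] [Module 𝕜 X] [AddCommGroup Y]
  [Module 𝕜 Y] [TopologicalSpace Y] [IsTopologicalAddGroup Y] [ContinuousSMul 𝕜 Y] [T2Space Y]
  {τ : AddChar E (Module.End 𝕜 X)} {J : X →ₗ[𝕜] Y}

theorem map_addChar_le_of_dense (hJ : Function.Injective J)
    (hτ : ∀ x, Continuous fun y => J (τ y x)) {Z : Submodule 𝕜 X} [FiniteDimensional 𝕜 Z]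
    {s : Set E} (h : ∀ a ∈ s, Z.map (τ a) ≤ Z) (hs : Dense (AddSubgroup.closure s : Set E))
    (y : E) : Z.map (τ y) ≤ Z := by
  rintro _ ⟨x, hx, rfl⟩
  have hclosed : IsClosed {y | J (τ y x) ∈ Z.map J} :=
    (Z.map J).closed_of_finiteDimensional.preimage (hτ x)
  have hsub : (AddSubgroup.closure s : Set E) ⊆ {y | J (τ y x) ∈ Z.map J} := fun a ha =>
    Submodule.mem_map_of_mem ((map_addChar_eq_of_mem_closure h ha).le (Submodule.mem_map_of_mem hx))
  have huniv : {y | J (τ y x) ∈ Z.map J} = Set.univ :=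
    (hs.mono hsub).closure_eq ▸ hclosed.closure_eq.symm
  exact hJ.mem_set_image.1 (huniv.symm ▸ Set.mem_univ y : y ∈ {y | J (τ y x) ∈ Z.map J})

theorem exists_invariant_of_sub_one_pow (hJ : Function.Injective J)
    (hτ : ∀ x, Continuous fun y => J (τ y x)) {ι : Type*} [Finite ι] {h : ι → E} {m : ι → ℕ}
    (hm : ∀ k, 0 < m k) (hdense : Dense (AddSubgroup.closure (Set.range h) : Set E))
    {W H : Submodule 𝕜 X} [FiniteDimensional 𝕜 W] [FiniteDimensional 𝕜 H]
    (hW : ∀ k, W.map ((τ (h k) - 1) ^ m k) ≤ H) (hH : ∀ k, H.map ((τ (h k) - 1) ^ m k) ≤ H) :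
    ∃ Z : Submodule 𝕜 X, FiniteDimensional 𝕜 Z ∧ (∀ y, Z.map (τ y) ≤ Z) ∧
      (W : Set X) ∪ (H : Set X) ⊆ (Z : Set X) := by
  have hcomm (a b : E) : Commute (τ a - 1) (τ b - 1) := by
    have hab : Commute (τ a) (τ b) := by
      rw [Commute, SemiconjBy, ← τ.map_add_eq_mul, ← τ.map_add_eq_mul, add_comm]
    exact (hab.sub_left (Commute.one_left _)).sub_right (Commute.one_right _)
  have hWH (k : ι) : (W ⊔ H).map ((τ (h k) - 1) ^ m k) ≤ W ⊔ H := by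
    rw [Submodule.map_sup]
    exact (sup_le (hW k) (hH k)).trans le_sup_right
  obtain ⟨Z, hfg, hWHZ, hinv⟩ := exists_fg_map_le_of_map_pow_le (fun k l => hcomm (h k) (h l)) hm
    (Module.Finite.iff_fg.1 inferInstance : (W ⊔ H).FG) hWH
  have : FiniteDimensional 𝕜 Z := Module.Finite.iff_fg.2 hfg
  refine ⟨Z, this, map_addChar_le_of_dense hJ hτ ?_ hdense,
    Set.union_subset (sup_le_iff.1 hWHZ).1 (sup_le_iff.1 hWHZ).2⟩
  rintro _ ⟨k, rfl⟩ _ ⟨x, hx, rfl⟩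
  simpa using Z.add_mem (hinv k (Submodule.mem_map_of_mem hx)) hx

end WeaklyContinuousAction

section Restriction

variable {E : Type*} [AddCommGroup E] {𝕜 X : Type*}

/-- The action on a subspace `Z` that is invariant under the action `τ`. -/
def restrictAction [Semiring 𝕜] [AddCommMonoid X] [Module 𝕜 X] (τ : AddChar E (Module.End 𝕜 X))
    (Z : Submodule 𝕜 X) (hZ : ∀ y, Z.map (τ y) ≤ Z) : AddChar E (Module.End 𝕜 Z) where
  toFun y := (τ y).restrict fun _ hz => hZ y (Submodule.mem_map_of_mem hz)
  map_zero_eq_one' := by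
    ext z
    simp
  map_add_eq_mul' a b := by
    ext z
    simp [τ.map_add_eq_mul]

theorem continuous_dual_restrictAction [TopologicalSpace E] [NontriviallyNormedField 𝕜]
    [CompleteSpace 𝕜] [AddCommGroup X] [Module 𝕜 X] {Y : Type*} [AddCommGroup Y]
    [Module 𝕜 Y] [TopologicalSpace Y] [IsTopologicalAddGroup Y] [ContinuousSMul 𝕜 Y] [T2Space Y]
    {τ : AddChar E (Module.End 𝕜 X)} {J : X →ₗ[𝕜] Y} (hJ : Function.Injective J)
    (hτ : ∀ x, Continuous fun y => J (τ y x)) {Z : Submodule 𝕜 X} [FiniteDimensional 𝕜 Z]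
    (hZ : ∀ y, Z.map (τ y) ≤ Z) (f : Module.Dual 𝕜 Z) (z : Z) :
    Continuous fun y => f (restrictAction τ Z hZ y z) := by
  let e : Z ≃ₗ[𝕜] Z.map J := Z.equivMapOfInjective J hJ
  have hf : Continuous (f ∘ₗ e.symm.toLinearMap) := LinearMap.continuous_of_finiteDimensional _
  have horbit : Continuous fun y => e (restrictAction τ Z hZ y z) :=
    Continuous.subtype_mk (hτ z) _
  simpa [Function.comp_def] using hf.comp horbit

end Restriction

/-! ### The algebra of exponential polynomials -/

section ExpPoly

variable {d : ℕ}

theorem IsExpPoly.of_fintype {ι : Type*} [Fintype ι] {f : Euc d → ℂ}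
    (p : ι → MvPolynomial (Fin d) ℂ) (l : ι → Fin d → ℂ)
    (hf : ∀ x : Euc d, f x = ∑ i, MvPolynomial.eval (fun j => (x j : ℂ)) (p i) *
      Complex.exp (∑ j, l i j * (x j : ℂ))) : IsExpPoly f := by
  let e := Fintype.equivFin ι
  refine ⟨Fintype.card ι, p ∘ e.symm, l ∘ e.symm, fun x => (hf x).trans ?_⟩
  exact (Equiv.sum_comp e.symm _).symm

theorem isExpPoly_eval_mul_exp (p : MvPolynomial (Fin d) ℂ) (l : Fin d → ℂ) :
    IsExpPoly fun x : Euc d => MvPolynomial.eval (fun j => (x j : ℂ)) p *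
      Complex.exp (∑ j, l j * (x j : ℂ)) :=
  .of_fintype (ι := Unit) (fun _ => p) (fun _ => l) fun x => by simp

theorem isExpPoly_const (c : ℂ) : IsExpPoly fun _ : Euc d => c := by
  simpa using isExpPoly_eval_mul_exp (d := d) (.C c) 0

theorem IsExpPoly.continuous {f : Euc d → ℂ} (hf : IsExpPoly f) : Continuous f := by
  obtain ⟨n, p, l, hf⟩ := hf
  rw [funext hf]
  refine continuous_finsetSum _ fun i _ => Continuous.mul ?_ (by fun_prop)
  exact (MvPolynomial.continuous_eval (p i)).comp (by fun_prop)

variable (d) in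
/-- The algebra of continuous exponential polynomials on `ℝ^d`. -/
def expPoly : Subalgebra ℂ (Euc d → ℂ) where
  carrier := {f | IsExpPoly f}
  add_mem' := by
    rintro f g ⟨n, p, l, hf⟩ ⟨n', p', l', hg⟩
    exact .of_fintype (Sum.elim p p') (Sum.elim l l') fun x => by simp [hf, hg]
  mul_mem' := by
    rintro f g ⟨n, p, l, hf⟩ ⟨n', p', l', hg⟩
    refine .of_fintype (fun i : Fin n × Fin n' => p i.1 * p' i.2) (fun i => l i.1 + l' i.2)
      fun x => ?_
    rw [Pi.mul_apply, hf, hg, Finset.sum_mul_sum, Fintype.sum_prod_type]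
    refine Finset.sum_congr rfl fun i _ => Finset.sum_congr rfl fun j _ => ?_
    simp only [map_mul, Pi.add_apply, add_mul, Finset.sum_add_distrib, Complex.exp_add]
    ring
  algebraMap_mem' := isExpPoly_const

theorem mem_expPoly {f : Euc d → ℂ} : f ∈ expPoly d ↔ IsExpPoly f := Iff.rfl

theorem coord_mem_expPoly (j : Fin d) : (fun x : Euc d => (x j : ℂ)) ∈ expPoly d := by
  simpa [mem_expPoly] using isExpPoly_eval_mul_exp (d := d) (.X j) 0

theorem exp_coord_mem_expPoly (μ : ℂ) (j : Fin d) :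
    (fun x : Euc d => Complex.exp (μ * x j)) ∈ expPoly d := by
  simpa [mem_expPoly, Pi.single_apply] using isExpPoly_eval_mul_exp (d := d) 1 (Pi.single j μ)

end ExpPoly

/-! ### One-parameter groups in Banach algebras -/

section OneParameterGroup

variable {A : Type*} [NormedRing A] [NormedAlgebra ℝ A] {M : AddChar ℝ A}

theorem hasDerivAt_addChar_of_differentiable (hM : Differentiable ℝ M) (t : ℝ) :
    HasDerivAt M (M t * deriv M 0) t := by
  have h0 : HasDerivAt M (deriv M 0) (t - t) := by
    rw [sub_self]
    exact (hM 0).hasDerivAt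
  refine ((h0.comp_sub_const t t).const_mul (M t)).congr_of_eventuallyEq (.of_forall fun s => ?_)
  simp only [← M.map_add_eq_mul, add_sub_cancel]

variable [CompleteSpace A]

theorem exists_isUnit_intervalIntegral (hM : Continuous M) :
    ∃ c, IsUnit (∫ s in (0 : ℝ)..c, M s) := by
  have hslope := hasDerivAt_iff_tendsto_slope.1
    (hM.integral_hasStrictDerivAt 0 0).hasDerivAt
  rw [M.map_zero_eq_one] at hslope
  obtain ⟨c, hc, hc0⟩ := ((hslope.eventually (Units.isOpen.mem_nhds isUnit_one)).and
    self_mem_nhdsWithin).exists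
  have hmean : IsUnit (c⁻¹ • ∫ s in (0 : ℝ)..c, M s) := by simpa [slope_def_module] using hc
  exact ⟨c, (isUnit_smul_iff (Units.mk0 c hc0)⁻¹ _).1 hmean⟩

theorem mul_intervalIntegral_eq (hM : Continuous M) (c t : ℝ) :
    M t * ∫ s in (0 : ℝ)..c, M s = ∫ s in t..t + c, M s := by
  have h := (ContinuousLinearMap.mul ℝ A (M t)).intervalIntegral_comp_comm
    (hM.intervalIntegrable (μ := volume) 0 c)
  simp only [ContinuousLinearMap.mul_apply', ← M.map_add_eq_mul] at h
  rw [← h, intervalIntegral.integral_comp_add_left (fun s => M s), add_zero]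

/-- The smoothness of `u ↦ ∫₀ᵘ M` passes to `M` on dividing by an invertible value of it. -/
theorem differentiable_addChar_of_continuous (hM : Continuous M) : Differentiable ℝ M := by
  obtain ⟨c, u, hu⟩ := exists_isUnit_intervalIntegral hM
  have hprimitive : Differentiable ℝ fun t => ∫ s in (0 : ℝ)..t, M s := fun t =>
    (hM.integral_hasStrictDerivAt 0 t).hasDerivAt.differentiableAt
  have hM_eq (t : ℝ) :
      M t = ((∫ s in (0 : ℝ)..t + c, M s) - ∫ s in (0 : ℝ)..t, M s) * ↑u⁻¹ := by
    rw [Units.eq_mul_inv_iff_mul_eq, hu, mul_intervalIntegral_eq hM,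
      intervalIntegral.integral_interval_sub_left (hM.intervalIntegrable _ _)
        (hM.intervalIntegrable _ _)]
  rw [funext hM_eq]
  exact ((hprimitive.comp (differentiable_id.add_const c)).sub hprimitive).mul_const _

theorem exists_addChar_eq_exp_smul (hM : Continuous M) :
    ∃ b : A, ∀ t, M t = NormedSpace.exp (t • b) := by
  let b := deriv M 0
  have hderiv (t : ℝ) : HasDerivAt (fun t => M t * NormedSpace.exp (t • -b)) 0 t := by
    refine ((hasDerivAt_addChar_of_differentiable (differentiable_addChar_of_continuous hM) t).mul
      (hasDerivAt_exp_smul_const' (-b) t)).congr_deriv ?_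
    noncomm_ring
  have hconst (t : ℝ) : M t * NormedSpace.exp (t • -b) = 1 := by
    simpa using is_const_of_deriv_eq_zero (fun t => (hderiv t).differentiableAt)
      (fun t => (hderiv t).deriv) t 0
  have hinv (t : ℝ) : NormedSpace.exp (t • -b) * NormedSpace.exp (t • b) = 1 := by
    let _ : NormedAlgebra ℚ A := NormedAlgebra.restrictScalars ℚ ℝ A
    rw [← NormedSpace.exp_add_of_commute (((Commute.refl b).neg_left.smul_left t).smul_right t),
      smul_neg, neg_add_cancel, NormedSpace.exp_zero]
  exact ⟨b, fun t => by rw [← mul_one (M t), ← hinv t, ← mul_assoc, hconst, one_mul]⟩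

end OneParameterGroup

/-! ### Continuous characters of `ℝ^d` in finite-dimensional algebras -/

section Exp

variable {A : Type*} [NormedRing A] [CompleteSpace A]

theorem exp_mul_eq_sum_of_pow_mul_eq_zero (𝕂 : Type*) [NontriviallyNormedField 𝕂] [CharZero 𝕂]
    [ContinuousSMul ℚ 𝕂] [NormedAlgebra 𝕂 A] {a x : A} {k : ℕ} (h : a ^ k * x = 0) :
    NormedSpace.exp a * x = ∑ i ∈ Finset.range k, (i.factorial : 𝕂)⁻¹ • (a ^ i * x) := by
  have hsum := (NormedSpace.exp_series_hasSum_exp' (𝕂 := 𝕂) a).mul_right x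
  simp only [smul_mul_assoc] at hsum
  refine hsum.unique (hasSum_sum_of_ne_finset_zero fun i hi => ?_)
  obtain ⟨j, rfl⟩ := Nat.exists_eq_add_of_le' (not_lt.1 (Finset.mem_range.not.1 hi))
  rw [pow_add, mul_assoc, h, mul_zero, smul_zero]

theorem exp_smul_mul_eq_sum [NormedAlgebra ℂ A] {b x : A} {μ : ℂ} {k : ℕ}
    (h : (b - algebraMap ℂ A μ) ^ k * x = 0) (t : ℝ) :
    NormedSpace.exp (t • b) * x = ∑ i ∈ Finset.range k,
      (Complex.exp (μ * t) * ((i.factorial : ℂ)⁻¹ * (t : ℂ) ^ i)) •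
        ((b - algebraMap ℂ A μ) ^ i * x) := by
  let _ : NormedAlgebra ℚ A := NormedAlgebra.restrictScalars ℚ ℂ A
  set n := b - algebraMap ℂ A μ with hn
  have hb : t • b = algebraMap ℂ A (μ * t) + (t : ℂ) • n := by
    rw [hn, smul_sub, mul_comm, map_mul, ← Algebra.smul_def, add_sub_cancel, Complex.coe_smul]
  have hpow : ((t : ℂ) • n) ^ k * x = 0 := by rw [smul_pow, smul_mul_assoc, h, smul_zero]
  rw [hb, NormedSpace.exp_add_of_commute (Algebra.commutes _ _), ← NormedSpace.algebraMap_exp_comm,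
    ← Complex.exp_eq_exp_ℂ, mul_assoc, exp_mul_eq_sum_of_pow_mul_eq_zero ℂ hpow,
    ← Algebra.smul_def, Finset.smul_sum]
  simp only [smul_pow, smul_mul_assoc, smul_smul]

end Exp

section Coefficients

theorem dual_mul_mem {K Y A : Type*} [Field K] [Ring A] [Algebra K A] [FiniteDimensional K A]
    {S : Subalgebra K (Y → K)} {F G : Y → A} (hF : ∀ f : Module.Dual K A, (fun y => f (F y)) ∈ S)
    (hG : ∀ f : Module.Dual K A, (fun y => f (G y)) ∈ S) (f : Module.Dual K A) :
    (fun y => f (F y * G y)) ∈ S := by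
  let b := Module.finBasis K A
  have hfFG : (fun y => f (F y * G y)) = ∑ i, (fun y => b.coord i (G y)) *
      fun y => (f ∘ₗ LinearMap.mulRight K (b i)) (F y) := by
    ext y
    conv_lhs => rw [← b.sum_repr (G y), Finset.mul_sum, map_sum]
    simp
  rw [hfFG]
  exact S.sum_mem fun i _ => S.mul_mem (hG _) (hF _)

variable {d : ℕ} {A : Type*} [NormedRing A] [NormedAlgebra ℂ A] [FiniteDimensional ℂ A]

theorem isExpPoly_dual_exp_coord_smul_mul (b x : A) (j : Fin d) (f : Module.Dual ℂ A) :
    IsExpPoly fun y : Euc d => f (NormedSpace.exp (y j • b) * x) := by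
  have : CompleteSpace A := FiniteDimensional.complete ℂ A
  let coeff : A →ₗ[ℂ] Euc d → ℂ :=
    LinearMap.pi fun y => f ∘ₗ LinearMap.mulLeft ℂ (NormedSpace.exp (y j • b))
  suffices h : ⨆ μ, Module.End.maxGenEigenspace (LinearMap.mulLeft ℂ b) μ ≤
      (expPoly d).toSubmodule.comap coeff by
    rw [Module.End.iSup_maxGenEigenspace_eq_top] at h
    exact h trivial
  refine iSup_le fun μ x hx => ?_
  obtain ⟨k, hk⟩ := (Module.End.mem_maxGenEigenspace _ _ _).1 hx
  have hbx : (b - algebraMap ℂ A μ) ^ k * x = 0 := by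
    rw [← LinearMap.mulLeft_apply (R := ℂ), ← LinearMap.pow_mulLeft, ← hk]
    congr 2
    ext z
    simp [sub_mul, Algebra.smul_def]
  have hcoeff : coeff x = ∑ i ∈ Finset.range k, f ((b - algebraMap ℂ A μ) ^ i * x) •
      ((fun y : Euc d => Complex.exp (μ * y j)) *
        (i.factorial : ℂ)⁻¹ • (fun y : Euc d => (y j : ℂ)) ^ i) := by
    ext y
    simp [coeff, exp_smul_mul_eq_sum hbx, mul_comm, mul_left_comm]
  rw [Submodule.mem_comap, hcoeff]
  exact sum_mem fun i _ => (expPoly d).smul_mem (mul_mem (exp_coord_mem_expPoly μ j)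
    ((expPoly d).smul_mem (pow_mem (coord_mem_expPoly j) i) _)) _

theorem isExpPoly_dual_addChar {M : AddChar (Euc d) A} (hM : Continuous M)
    (f : Module.Dual ℂ A) : IsExpPoly fun y => f (M y) := by
  have : CompleteSpace A := FiniteDimensional.complete ℂ A
  let e := EuclideanSpace.basisFun (Fin d) ℝ
  suffices h : ∀ (s : Finset (Fin d)) (f : Module.Dual ℂ A),
      IsExpPoly fun y : Euc d => f (M (∑ j ∈ s, y j • e j)) by
    have hsum (y : Euc d) : ∑ j, y j • e j = y := e.sum_repr y
    simpa only [hsum] using h Finset.univ f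
  intro s
  induction s using Finset.induction_on with
  | empty =>
    intro f
    simpa using isExpPoly_const (f 1)
  | insert j s hj ih =>
    let line : ℝ →+ Euc d := (LinearMap.toSpanSingleton ℝ (Euc d) (e j)).toAddMonoidHom
    have hline : Continuous line := continuous_id.smul continuous_const
    obtain ⟨b, hb⟩ := exists_addChar_eq_exp_smul (M := M.compAddMonoidHom line) (hM.comp hline)
    have hfactor (y : Euc d) : M (∑ i ∈ insert j s, y i • e i) =
        NormedSpace.exp (y j • b) * M (∑ i ∈ s, y i • e i) := by
      rw [Finset.sum_insert hj, M.map_add_eq_mul, ← hb]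
      rfl
    simp_rw [hfactor]
    refine dual_mul_mem (S := expPoly d) (fun f => ?_) ih
    simpa [mem_expPoly] using isExpPoly_dual_exp_coord_smul_mul b 1 j f

open scoped Matrix.Norms.Operator in
theorem isExpPoly_dual_addChar_apply {V : Type*} [AddCommGroup V] [Module ℂ V]
    [FiniteDimensional ℂ V] {ρ : AddChar (Euc d) (Module.End ℂ V)}
    (hρ : ∀ (f : Module.Dual ℂ V) (x : V), Continuous fun y => f (ρ y x))
    (f : Module.Dual ℂ V) (x : V) : IsExpPoly fun y => f (ρ y x) := by
  let b := Module.finBasis ℂ V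
  let e : Module.End ℂ V ≃ₐ[ℂ] Matrix _ _ ℂ := LinearMap.toMatrixAlgEquiv b
  let M := (MonoidHomClass.toMonoidHom e).compAddChar ρ
  have hM : Continuous M := continuous_matrix fun i j => by
    convert hρ (b.coord i) (b j) using 2 with y
    exact LinearMap.toMatrixAlgEquiv_apply b (ρ y) i j
  let g : Module.Dual ℂ (Matrix _ _ ℂ) := f ∘ₗ LinearMap.applyₗ x ∘ₗ e.symm.toLinearMap
  convert isExpPoly_dual_addChar hM g using 2 with y
  simp [g, M]

end Coefficients

/-! ### Continuous linear maps and weak integrals -/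

section WeakIntegral

theorem exists_strongDual_apply_eq_of_norm_le {𝕜 X B : Type*} [RCLike 𝕜] [AddCommGroup X]
    [Module 𝕜 X] [SeminormedAddCommGroup B] [NormedSpace 𝕜 B] {R : X →ₗ[𝕜] B}
    {u : Module.Dual 𝕜 X} {C : ℝ} (h : ∀ x, ‖u x‖ ≤ C * ‖R x‖) :
    ∃ g : StrongDual 𝕜 B, ∀ x, g (R x) = u x := by
  have hu : u ∈ (LinearMap.ker R).dualAnnihilator := by
    refine (Submodule.mem_dualAnnihilator _).2 fun x hx => norm_le_zero_iff.1 ?_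
    simpa [LinearMap.mem_ker.1 hx] using h x
  rw [← LinearMap.range_dualMap_eq_dualAnnihilator_ker] at hu
  obtain ⟨w, rfl⟩ := hu
  let v : StrongDual 𝕜 (LinearMap.range R) := (w.domRestrict _).mkContinuous C <| by
    rintro ⟨_, x, rfl⟩
    exact h x
  obtain ⟨g, hg, -⟩ := exists_extension_norm_eq _ v
  exact ⟨g, fun x => hg ⟨R x, x, rfl⟩⟩

variable {ι X : Type*} [AddCommGroup X] [Module ℝ X] [TopologicalSpace X] {B : ι → Type*}
  [∀ i, NormedAddCommGroup (B i)] [∀ i, NormedSpace ℝ (B i)] {J : ∀ i, X →L[ℝ] B i}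

theorem exists_strongDual_pi_apply_eq
    (hJ : WithSeminorms fun i => (normSeminorm ℝ (B i)).comp (J i).toLinearMap)
    (u : StrongDual ℝ X) :
    ∃ (s : Finset ι) (g : StrongDual ℝ (∀ i : s, B i)), ∀ x, g (fun i => J i x) = u x := by
  obtain ⟨s, C, -, hC⟩ := Seminorm.bound_of_continuous hJ
    ((normSeminorm ℝ ℝ).comp u.toLinearMap) (continuous_norm.comp u.continuous)
  let R : X →ₗ[ℝ] ∀ i : s, B i := LinearMap.pi fun i => (J i).toLinearMap
  have hbound (x : X) : ‖u x‖ ≤ C * ‖R x‖ := (hC x).trans <| mul_le_mul_of_nonneg_left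
    (Seminorm.finset_sup_apply_le (norm_nonneg _) fun i hi => norm_le_pi_norm (R x) ⟨i, hi⟩) C.2
  exact ⟨s, exists_strongDual_apply_eq_of_norm_le (u := u.toLinearMap) hbound⟩

variable {E : Type*} [TopologicalSpace E] [MeasurableSpace E] [OpensMeasurableSpace E]
  {μ : Measure E} [IsFiniteMeasureOnCompacts μ] {F : E → X} {V : Type*} [NormedAddCommGroup V]
  [NormedSpace ℝ V]

theorem integrable_apply_of_hasCompactSupport (hF : Continuous F) (hFc : HasCompactSupport F)
    (u : X →L[ℝ] V) : Integrable (fun z => u (F z)) μ :=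
  (u.continuous.comp hF).integrable_of_hasCompactSupport (hFc.comp_left (map_zero u))

theorem apply_eq_integral_of_withSeminorms [∀ i, CompleteSpace (B i)] [CompleteSpace V]
    (hJ : WithSeminorms fun i => (normSeminorm ℝ (B i)).comp (J i).toLinearMap)
    (hF : Continuous F) (hFc : HasCompactSupport F) {x : X}
    (hx : ∀ i, J i x = ∫ z, J i (F z) ∂μ) (u : X →L[ℝ] V) : u x = ∫ z, u (F z) ∂μ := by
  refine (SeparatingDual.eq_iff_forall_dual_eq (R := ℝ)).2 fun v => ?_
  obtain ⟨s, g, hg⟩ := exists_strongDual_pi_apply_eq hJ (v.comp u)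
  let R : X →L[ℝ] ∀ i : s, B i := ContinuousLinearMap.pi fun i => J i
  have hR : R x = ∫ z, R (F z) ∂μ := by
    ext i
    exact (hx i).trans (eval_integral
      (fun i : s => integrable_apply_of_hasCompactSupport hF hFc (J i)) i).symm
  calc v (u x) = g (R x) := (hg x).symm
    _ = ∫ z, g (R (F z)) ∂μ := by
      rw [hR, g.integral_comp_comm (integrable_apply_of_hasCompactSupport hF hFc R)]
    _ = ∫ z, v (u (F z)) ∂μ := integral_congr_ae (.of_forall fun z => hg (F z))
    _ = v (∫ z, u (F z) ∂μ) :=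
      v.integral_comp_comm (integrable_apply_of_hasCompactSupport hF hFc u)

end WeakIntegral

/-! ### Integrals of families of test functions -/

section SmoothFunctions

open scoped BoundedContinuousFunction ContDiff

theorem uniformContinuous_of_uniformContinuous_uncurry {E E' V : Type*} [PseudoMetricSpace E]
    [PseudoMetricSpace E'] [PseudoMetricSpace V] {F : E → E' →ᵇ V}
    (hF : UniformContinuous fun p : E × E' => F p.1 p.2) : UniformContinuous F := by
  refine Metric.uniformContinuous_iff.2 fun ε hε => ?_
  obtain ⟨δ, hδ, h⟩ := Metric.uniformContinuous_iff.1 hF (ε / 2) (half_pos hε)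
  refine ⟨δ, hδ, fun z z' hz => lt_of_le_of_lt
    ((BoundedContinuousFunction.dist_le (half_pos hε).le).2 fun x => ?_) (half_lt_self hε)⟩
  exact (h (a := (z, x)) (b := (z', x)) (by simpa [Prod.dist_eq, hδ] using hz)).le

theorem integral_boundedContinuousFunction_apply {α E V : Type*} [MeasurableSpace α]
    {μ : Measure α} [TopologicalSpace E] [NormedAddCommGroup V] [NormedSpace ℝ V] [CompleteSpace V]
    {F : α → E →ᵇ V} (hF : Integrable F μ) (x : E) :
    (∫ z, F z ∂μ) x = ∫ z, F z x ∂μ :=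
  ((BoundedContinuousFunction.evalCLM ℝ x).integral_comp_comm hF).symm

variable {E : Type*} [NormedAddCommGroup E] [NormedSpace ℝ E] [MeasurableSpace E] [BorelSpace E]
  {μ : Measure E}

theorem apply_eq_integral_of_iteratedFDeriv_eq [IsFiniteMeasureOnCompacts μ] {K : Compacts E}
    {F : E → 𝓓^{⊤}_{K}(E, ℝ)} (hF : Continuous F) (hFc : HasCompactSupport F)
    {f : 𝓓^{⊤}_{K}(E, ℝ)}
    (hf : ∀ i x, iteratedFDeriv ℝ i f x = ∫ z, iteratedFDeriv ℝ i (F z) x ∂μ)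
    {V : Type*} [NormedAddCommGroup V] [NormedSpace ℝ V] [CompleteSpace V]
    (u : 𝓓^{⊤}_{K}(E, ℝ) →L[ℝ] V) : u f = ∫ z, u (F z) ∂μ := by
  let J (i : ℕ) : 𝓓^{⊤}_{K}(E, ℝ) →L[ℝ] E →ᵇ (E [×i]→L[ℝ] ℝ) :=
    ContDiffMapSupportedIn.structureMapCLM ℝ ⊤ i
  have hJ : WithSeminorms fun i =>
      (normSeminorm ℝ (E →ᵇ (E [×i]→L[ℝ] ℝ))).comp (J i).toLinearMap :=
    ContDiffMapSupportedIn.withSeminorms ℝ E ℝ ⊤ K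
  refine apply_eq_integral_of_withSeminorms (B := fun i => E →ᵇ (E [×i]→L[ℝ] ℝ)) hJ hF hFc
    (fun i => ?_) u
  ext1 x
  rw [integral_boundedContinuousFunction_apply
    (integrable_apply_of_hasCompactSupport hF hFc (J i))]
  simpa [J, ContDiffMapSupportedIn.structureMapCLM_top_apply] using hf i x

theorem iteratedFDeriv_integral_smul_comp_sub [SFinite μ] [μ.IsAddLeftInvariant] {φ ψ : E → ℝ}
    (hφ : LocallyIntegrable φ μ) (hψ : ContDiff ℝ ∞ ψ) (hψc : HasCompactSupport ψ) (i : ℕ) :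
    (iteratedFDeriv ℝ i fun x => ∫ z, φ z • ψ (x - z) ∂μ) =
      fun x => ∫ z, φ z • iteratedFDeriv ℝ i ψ (x - z) ∂μ := by
  induction i with
  | zero =>
    ext1 x
    simp only [iteratedFDeriv_zero_eq_comp, Function.comp_apply]
    rw [← LinearIsometryEquiv.coe_toContinuousLinearEquiv,
      ← ContinuousLinearEquiv.integral_comp_comm]
    simp only [map_smul]
  | succ i ih =>
    ext1 x
    have hψi : ContDiff ℝ 1 (iteratedFDeriv ℝ i ψ) :=
      hψ.iteratedFDeriv_right (by exact_mod_cast le_top)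
    have hfderiv : fderiv ℝ (fun x => ∫ z, φ z • iteratedFDeriv ℝ i ψ (x - z) ∂μ) x =
        ∫ z, φ z • fderiv ℝ (iteratedFDeriv ℝ i ψ) (x - z) ∂μ :=
      ((hψc.iteratedFDeriv (𝕜 := ℝ) i).hasFDerivAt_convolution_right
        (ContinuousLinearMap.lsmul ℝ ℝ) hφ hψi x).fderiv
    let uncurry : (E →L[ℝ] E [×i]→L[ℝ] ℝ) ≃L[ℝ] E [×(i + 1)]→L[ℝ] ℝ :=
      (continuousMultilinearCurryLeftEquiv ℝ (fun _ : Fin (i + 1) => E)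
        ℝ).symm.toContinuousLinearEquiv
    calc iteratedFDeriv ℝ (i + 1) (fun x => ∫ z, φ z • ψ (x - z) ∂μ) x
        = uncurry (∫ z, φ z • fderiv ℝ (iteratedFDeriv ℝ i ψ) (x - z) ∂μ) := by
          rw [iteratedFDeriv_succ_eq_comp_left, ih, Function.comp_apply, hfderiv]
          rfl
      _ = ∫ z, uncurry (φ z • fderiv ℝ (iteratedFDeriv ℝ i ψ) (x - z)) ∂μ :=
          (uncurry.integral_comp_comm (𝕜 := ℝ) (μ := μ) (E := E →L[ℝ] E [×i]→L[ℝ] ℝ)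
            (F := E [×(i + 1)]→L[ℝ] ℝ) _).symm
      _ = ∫ z, φ z • iteratedFDeriv ℝ (i + 1) ψ (x - z) ∂μ := by
          simp only [map_smul]
          rfl

end SmoothFunctions

/-! ### Distributions and convolutions -/

section Convolution

open scoped ContDiff Pointwise

variable {d : ℕ}

/-- The sum of the supports of `φ` and `ψ`, which contains the support of their convolution. -/
def supportSum (φ ψ : TestFun d) : Compacts (Euc d) :=
  ⟨tsupport φ + tsupport ψ, φ.hasCompactSupport.isCompact.add ψ.hasCompactSupport.isCompact⟩

/-- The function `φ z • τ_{-z} ψ`, whose integral over `z` is the convolution of `φ` and `ψ`. For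
all `z` it is supported in the same compact set, so that the integral makes sense in a space on
which the topology is given by countably many seminorms. -/
def mulTranslate (φ ψ : TestFun d) (z : Euc d) : 𝓓^{⊤}_{supportSum φ ψ}(Euc d, ℝ) where
  toFun x := φ z • ψ (x - z)
  contDiff' := (ψ.contDiff.comp (contDiff_id.sub contDiff_const)).const_smul (φ z)
  zero_on_compl' x hx := by
    by_contra h
    exact hx ⟨z, subset_tsupport _ (left_ne_zero_of_smul h), x - z,
      subset_tsupport _ (right_ne_zero_of_smul h), add_sub_cancel z x⟩

theorem mulTranslate_apply (φ ψ : TestFun d) (z x : Euc d) :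
    mulTranslate φ ψ z x = φ z • ψ (x - z) := rfl

theorem iteratedFDeriv_mulTranslate (φ ψ : TestFun d) (i : ℕ) (z x : Euc d) :
    iteratedFDeriv ℝ i (mulTranslate φ ψ z) x = φ z • iteratedFDeriv ℝ i ψ (x - z) := by
  have hψ : ContDiffAt ℝ i (fun x => ψ (x - z)) x :=
    (ContDiff.of_le (n := ∞) (ψ.contDiff.comp (contDiff_id.sub contDiff_const))
      (by exact_mod_cast le_top)).contDiffAt
  rw [← iteratedFDeriv_comp_sub (f := ψ) i z x]
  exact iteratedFDeriv_const_smul_apply' hψ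

theorem hasCompactSupport_mulTranslate (φ ψ : TestFun d) :
    HasCompactSupport (mulTranslate φ ψ) := by
  refine φ.hasCompactSupport.mono (Function.support_subset_iff'.2 fun z hz => ?_)
  ext x
  rw [mulTranslate_apply, Function.notMem_support.1 hz, zero_smul]
  rfl

theorem hasCompactSupport_uncurry_smul_comp_sub {G V : Type*} [TopologicalSpace G] [R1Space G]
    [AddCommGroup G] [IsTopologicalAddGroup G] [AddCommGroup V] [Module ℝ V] {φ : G → ℝ}
    {ψ : G → V} (hφ : HasCompactSupport φ) (hψ : HasCompactSupport ψ) :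
    HasCompactSupport fun p : G × G => φ p.1 • ψ (p.2 - p.1) := by
  have hK : IsCompact ((fun p : G × G => (p.1, p.2 + p.1)) '' (tsupport φ ×ˢ tsupport ψ)) :=
    (hφ.isCompact.prod hψ.isCompact).image (by fun_prop)
  refine HasCompactSupport.intro hK fun p hp => ?_
  by_contra h
  exact hp ⟨(p.1, p.2 - p.1), ⟨subset_tsupport _ (left_ne_zero_of_smul h),
    subset_tsupport _ (right_ne_zero_of_smul h)⟩, by simp⟩

theorem continuous_mulTranslate (φ ψ : TestFun d) : Continuous (mulTranslate φ ψ) := by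
  refine (ContDiffMapSupportedIn.continuous_iff_comp _).2 fun i =>
    (uniformContinuous_of_uniformContinuous_uncurry ?_).continuous
  simp only [Function.comp_apply, ContDiffMapSupportedIn.structureMapCLM_top_apply,
    iteratedFDeriv_mulTranslate]
  have hψ : Continuous (iteratedFDeriv ℝ i ψ) :=
    ψ.contDiff.continuous_iteratedFDeriv (by exact_mod_cast le_top)
  exact (hasCompactSupport_uncurry_smul_comp_sub φ.hasCompactSupport
    (ψ.hasCompactSupport.iteratedFDeriv i)).uniformContinuous_of_continuous
    ((φ.continuous.comp continuous_fst).smul (hψ.comp (continuous_snd.sub continuous_fst)))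

/-- The inclusion of the smooth functions supported in `K` into the test functions. -/
def inclTest (K : Compacts (Euc d)) : 𝓓^{⊤}_{K}(Euc d, ℝ) →L[ℝ] TestFun d :=
  TestFunction.ofSupportedInCLM ℝ (Set.subset_univ _)

theorem inclTest_mulTranslate (φ ψ : TestFun d) (z : Euc d) :
    inclTest _ (mulTranslate φ ψ z) = φ z • translateTest (-z) ψ := by
  ext x
  exact congrArg (fun y => φ z • ψ y) (sub_eq_add_neg x z)

theorem continuous_translateTest (ψ : TestFun d) : Continuous fun y => translateTest y ψ := by
  suffices h : Continuous fun y => translateTest (-y) ψ by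
    simpa only [Function.comp_def, neg_neg] using h.comp continuous_neg
  refine continuous_iff_continuousAt.2 fun y => ?_
  let b : ContDiffBump y := default
  let φ : TestFun d := ⟨b, b.contDiff, b.hasCompactSupport, fun _ _ => trivial⟩
  have hφ : Continuous fun z => φ z • translateTest (-z) ψ := by
    simpa only [Function.comp_def, inclTest_mulTranslate] using
      (inclTest _).continuous.comp (continuous_mulTranslate φ ψ)
  refine hφ.continuousAt.congr ?_
  filter_upwards [b.eventuallyEq_one] with z hz
  have hφz : φ z = 1 := hz
  rw [hφz, one_smul]

/-- The convolution of two test functions. -/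
def convTest (φ ψ : TestFun d) : TestFun d where
  toFun := convolution φ ψ (ContinuousLinearMap.lsmul ℝ ℝ) volume
  contDiff' := ψ.hasCompactSupport.contDiff_convolution_right _
    φ.continuous.locallyIntegrable ψ.contDiff
  hasCompactSupport' := φ.hasCompactSupport.convolution _ ψ.hasCompactSupport
  tsupport_subset' _ _ := trivial

theorem convTest_apply (φ ψ : TestFun d) (x : Euc d) :
    convTest φ ψ x = ∫ z, φ z • ψ (x - z) := rfl

theorem convTest_comm (φ ψ : TestFun d) : convTest φ ψ = convTest ψ φ := by
  ext x
  refine (convolution_lsmul_swap (μ := volume) (𝕜 := ℝ) (f := φ) (g := ψ) (x := x)).trans ?_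
  simp only [convTest_apply, smul_eq_mul, mul_comm]

theorem apply_convTest (T : Distr d) (φ ψ : TestFun d) :
    T (convTest φ ψ) = ∫ z, (φ z : ℂ) * T (translateTest (-z) ψ) := by
  let conv : 𝓓^{⊤}_{supportSum φ ψ}(Euc d, ℝ) :=
    { toFun := convTest φ ψ
      contDiff' := (convTest φ ψ).contDiff
      zero_on_compl' := fun x hx => integral_eq_zero_of_ae <|
        .of_forall fun z => (mulTranslate φ ψ z).zero_on_compl hx }
  have hconv (i : ℕ) (x : Euc d) : iteratedFDeriv ℝ i conv x =
      ∫ z, iteratedFDeriv ℝ i (mulTranslate φ ψ z) x := by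
    simp only [iteratedFDeriv_mulTranslate]
    exact congrFun (iteratedFDeriv_integral_smul_comp_sub φ.continuous.locallyIntegrable
      ψ.contDiff ψ.hasCompactSupport i) x
  let u : 𝓓^{⊤}_{supportSum φ ψ}(Euc d, ℝ) →L[ℝ] ℂ :=
    ContinuousLinearMap.comp (M₂ := TestFun d) T (inclTest _)
  have hu (z : Euc d) : u (mulTranslate φ ψ z) = (φ z : ℂ) * T (translateTest (-z) ψ) := by
    rw [← Complex.real_smul, ← map_smul, ← inclTest_mulTranslate]
    rfl
  calc T (convTest φ ψ) = u conv := rfl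
    _ = ∫ z, u (mulTranslate φ ψ z) := apply_eq_integral_of_iteratedFDeriv_eq
      (continuous_mulTranslate φ ψ) (hasCompactSupport_mulTranslate φ ψ) hconv u
    _ = ∫ z, (φ z : ℂ) * T (translateTest (-z) ψ) := by simp only [hu]

end Convolution

/-! ### Translations of continuous functions -/

section ContinuousFunctions

/-- The translation operators on `C(ℝ^d)` as an action of `ℝ^d`. -/
def translateFunChar (d : ℕ) : AddChar (Euc d) (Module.End ℂ C(Euc d, ℂ)) where
  toFun := translateFun
  map_zero_eq_one' := by
    ext f x
    exact congrArg f (add_zero x)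
  map_add_eq_mul' a b := by
    ext f x
    exact congrArg f (add_assoc x a b).symm

variable {d : ℕ}

theorem diffFun_eq_pow (h : Euc d) (m : ℕ) : diffFun h m = (translateFunChar d h - 1) ^ m := by
  rw [← sum_choose_smul_addChar_nsmul (K := ℂ) (A := Module.End ℂ C(Euc d, ℂ))]
  rfl

theorem continuous_coe_translateFunChar (f : C(Euc d, ℂ)) :
    Continuous fun y => ContinuousMap.coeFnLinearMap ℂ (translateFunChar d y f) :=
  continuous_pi fun _ => f.continuous.comp (continuous_const.add continuous_id)

theorem isExpPoly_of_mem {Z : Submodule ℂ C(Euc d, ℂ)} [FiniteDimensional ℂ Z]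
    (hZ : ∀ y, Z.map (translateFun y) ≤ Z) {f : C(Euc d, ℂ)} (hf : f ∈ Z) : IsExpPoly f := by
  let ρ := restrictAction (translateFunChar d) Z hZ
  let evalZero : Module.Dual ℂ Z := LinearMap.proj 0 ∘ₗ ContinuousMap.coeFnLinearMap ℂ ∘ₗ Z.subtype
  have hρ (u : Module.Dual ℂ Z) (g : Z) : Continuous fun y => u (ρ y g) :=
    continuous_dual_restrictAction (J := ContinuousMap.coeFnLinearMap ℂ) DFunLike.coe_injective
      continuous_coe_translateFunChar hZ u g
  have hval (y : Euc d) : evalZero (ρ y ⟨f, hf⟩) = f y := congrArg f (zero_add y)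
  simpa only [hval] using isExpPoly_dual_addChar_apply (V := Z) hρ evalZero ⟨f, hf⟩

end ContinuousFunctions

/-! ### Translations of distributions -/

section Distributions

/-- The translation operators on distributions as an action of `ℝ^d`. -/
def translateDistrChar (d : ℕ) : AddChar (Euc d) (Module.End ℂ (Distr d)) where
  toFun := translateDistr
  map_zero_eq_one' := by
    ext T φ
    refine congrArg T (TestFunction.ext fun x => ?_)
    simp [translateTest_apply]
  map_add_eq_mul' a b := by
    ext T φ
    refine congrArg T (TestFunction.ext fun x => ?_)
    simp [translateTest_apply, add_assoc]

variable {d : ℕ}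

variable (d) in
/-- The underlying functions of distributions. The target carries the topology of pointwise
convergence, for which the orbit maps of translations are easily seen to be continuous. -/
def coeDistr : Distr d →ₗ[ℂ] TestFun d → ℂ where
  toFun T := T
  map_add' _ _ := rfl
  map_smul' _ _ := rfl

theorem coeDistr_injective : Function.Injective (coeDistr d) := DFunLike.coe_injective

theorem coeDistr_translateDistrChar_apply (y : Euc d) (T : Distr d) (φ : TestFun d) :
    coeDistr d (translateDistrChar d y T) φ = T (translateTest (-y) φ) := rfl

theorem diffDistr_eq_pow (h : Euc d) (m : ℕ) :
    diffDistr h m = (translateDistrChar d h - 1) ^ m := by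
  rw [← sum_choose_smul_addChar_nsmul (K := ℂ)]
  ext T φ
  refine Eq.trans ?_ (congrFun (congrArg (coeDistr d) (LinearMap.sum_apply ..).symm) φ)
  simp [diffDistr, transposeDistr_apply, diffTest, coeDistr_translateDistrChar_apply]

theorem continuous_coeDistr_translateDistrChar (T : Distr d) :
    Continuous fun y => coeDistr d (translateDistrChar d y T) :=
  continuous_pi fun φ => T.continuous.comp ((continuous_translateTest φ).comp continuous_neg)

variable (d) in
/-- The space of the distributions that are continuous exponential polynomials. -/
def expPolyDistr : Submodule ℂ (Distr d) where
  carrier := {T | IsExpPolyDistr T}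
  zero_mem' := ⟨fun _ => 0, isExpPoly_const 0, fun φ => by simp⟩
  add_mem' := by
    rintro S T ⟨f, hf, hS⟩ ⟨g, hg, hT⟩
    refine ⟨_, (expPoly d).add_mem hf hg, fun φ => ?_⟩
    have hint {u : Euc d → ℂ} (hu : IsExpPoly u) : Integrable fun x => (φ x : ℂ) * u x :=
      ((Complex.continuous_ofReal.comp φ.continuous).mul
        hu.continuous).integrable_of_hasCompactSupport
          (φ.hasCompactSupport.comp_left Complex.ofReal_zero).mul_right
    simp only [Pi.add_apply, mul_add]
    rw [integral_add (hint hf) (hint hg), ← hS, ← hT]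
    rfl
  smul_mem' := by
    rintro c T ⟨f, hf, hT⟩
    refine ⟨_, (expPoly d).smul_mem hf c, fun φ => ?_⟩
    simp only [Pi.smul_apply, mul_smul_comm]
    rw [integral_smul, ← hT]
    rfl

theorem isExpPolyDistr_of_apply_eq_integral {S T : Distr d} {φ : TestFun d}
    (hT : IsExpPoly fun z => T (translateTest (-z) φ))
    (hS : ∀ ψ, S ψ = ∫ z, (φ z : ℂ) * T (translateTest (-z) ψ)) : IsExpPolyDistr S :=
  ⟨_, hT, fun ψ => by rw [hS, ← apply_convTest, convTest_comm, apply_convTest]⟩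

end Distributions

/-! ### Regularization in finite-dimensional invariant spaces -/

section Regularization

open scoped ContDiff

variable {𝕜 V : Type*} [RCLike 𝕜] [AddCommGroup V] [Module 𝕜 V] [FiniteDimensional 𝕜 V]

theorem exists_forall_dual_apply_eq_integral {α : Type*} [MeasurableSpace α] {μ : Measure α}
    {o : α → V} (ho : ∀ f : Module.Dual 𝕜 V, Integrable (fun z => f (o z)) μ) :
    ∃ v, ∀ f : Module.Dual 𝕜 V, f v = ∫ z, f (o z) ∂μ := by
  let I : Module.Dual 𝕜 (Module.Dual 𝕜 V) :=
    { toFun := fun f => ∫ z, f (o z) ∂μ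
      map_add' := fun f g => integral_add (ho f) (ho g)
      map_smul' := fun c f => integral_const_mul c _ }
  refine ⟨(Module.evalEquiv 𝕜 V).symm I, fun f => ?_⟩
  rw [Module.apply_evalEquiv_symm_apply]
  rfl

theorem mem_of_forall_contDiff_integral_mem {E : Type*} [NormedAddCommGroup E] [NormedSpace ℝ E]
    [FiniteDimensional ℝ E] [MeasurableSpace E] [BorelSpace E] {μ : Measure E}
    [IsLocallyFiniteMeasure μ] [μ.IsOpenPosMeasure] {o : E → V}
    (ho : ∀ f : Module.Dual 𝕜 V, Continuous fun z => f (o z)) {P : Submodule 𝕜 V}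
    (hP : ∀ φ : E → ℝ, ContDiff ℝ ∞ φ → HasCompactSupport φ → ∀ v,
      (∀ f : Module.Dual 𝕜 V, f v = ∫ z, φ z • f (o z) ∂μ) → v ∈ P) (x : E) : o x ∈ P := by
  by_contra hx
  obtain ⟨f, hfx, hf⟩ := Submodule.exists_le_ker_of_notMem hx
  have hae : ∀ᵐ z ∂μ, f (o z) = 0 := by
    refine ae_eq_zero_of_integral_contDiff_smul_eq_zero (ho f).locallyIntegrable fun φ hφ hφc => ?_
    have hsmul (g : Module.Dual 𝕜 V) (z : E) :
        g (algebraMap ℝ 𝕜 (φ z) • o z) = φ z • g (o z) := by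
      rw [map_smul, algebraMap_smul]
    obtain ⟨v, hv⟩ := exists_forall_dual_apply_eq_integral (𝕜 := 𝕜) (μ := μ)
      (o := fun z => algebraMap ℝ 𝕜 (φ z) • o z) fun g => by
        simp only [hsmul]
        exact (hφ.continuous.smul (ho g)).integrable_of_hasCompactSupport hφc.smul_right
    simp only [hsmul] at hv
    rw [← hv f]
    exact hf (hP φ hφ hφc v hv)
  exact hfx (congrFun (((ho f).ae_eq_iff_eq μ continuous_const).1 hae) x)

theorem isExpPolyDistr_of_mem {d : ℕ} {Z : Submodule ℂ (Distr d)} [FiniteDimensional ℂ Z]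
    (hZ : ∀ y, Z.map (translateDistr y) ≤ Z) {T : Distr d} (hT : T ∈ Z) : IsExpPolyDistr T := by
  let ρ := restrictAction (translateDistrChar d) Z hZ
  let eval (φ : TestFun d) : Module.Dual ℂ Z := LinearMap.proj φ ∘ₗ coeDistr d ∘ₗ Z.subtype
  have hρ (f : Module.Dual ℂ Z) (S : Z) : Continuous fun y => f (ρ y S) :=
    continuous_dual_restrictAction coeDistr_injective continuous_coeDistr_translateDistrChar hZ f S
  suffices h : ρ 0 ⟨T, hT⟩ ∈ (expPolyDistr d).comap Z.subtype by
    rwa [ρ.map_zero_eq_one] at h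
  refine mem_of_forall_contDiff_integral_mem (μ := volume) (hρ · ⟨T, hT⟩)
    (fun φ hφ hφc S hS => ?_) 0
  exact isExpPolyDistr_of_apply_eq_integral (φ := ⟨φ, hφ, hφc, fun _ _ => trivial⟩)
    (isExpPoly_dual_addChar_apply hρ (eval _) ⟨T, hT⟩) fun ψ => hS (eval ψ)

end Regularization

end

theorem mainTheorem2 (d t : ℕ) (h : Fin t → Euc d) (m : Fin t → ℕ) (hm : ∀ k, 0 < m k)
    (hdense : Dense (AddSubgroup.closure (Set.range h) : Set (Euc d))) :
    (∀ W H : Submodule ℂ C(Euc d, ℂ),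
      FiniteDimensional ℂ W → FiniteDimensional ℂ H →
      (∀ k, W.map (diffFun (h k) (m k)) ≤ H) →
      (∀ k, H.map (diffFun (h k) (m k)) ≤ H) →
      (∃ Z : Submodule ℂ C(Euc d, ℂ), FiniteDimensional ℂ Z ∧
        (∀ y : Euc d, Z.map (translateFun y) ≤ Z) ∧
        (W : Set C(Euc d, ℂ)) ∪ (H : Set C(Euc d, ℂ)) ⊆ (Z : Set C(Euc d, ℂ))) ∧
      ∀ f ∈ (W : Set C(Euc d, ℂ)) ∪ (H : Set C(Euc d, ℂ)), IsExpPoly f) ∧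
    (∀ W H : Submodule ℂ (Distr d),
      FiniteDimensional ℂ W → FiniteDimensional ℂ H →
      (∀ k, W.map (diffDistr (h k) (m k)) ≤ H) →
      (∀ k, H.map (diffDistr (h k) (m k)) ≤ H) →
      (∃ Z : Submodule ℂ (Distr d), FiniteDimensional ℂ Z ∧
        (∀ y : Euc d, Z.map (translateDistr y) ≤ Z) ∧
        (W : Set (Distr d)) ∪ (H : Set (Distr d)) ⊆ (Z : Set (Distr d))) ∧
      ∀ T ∈ (W : Set (Distr d)) ∪ (H : Set (Distr d)), IsExpPolyDistr T) := by
  constructor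
  · intro W H _ _ hW hH
    simp only [diffFun_eq_pow] at hW hH
    obtain ⟨Z, hfin, hinv, hsub⟩ := exists_invariant_of_sub_one_pow
      (J := ContinuousMap.coeFnLinearMap ℂ) DFunLike.coe_injective continuous_coe_translateFunChar
      hm hdense hW hH
    exact ⟨⟨Z, hfin, hinv, hsub⟩, fun f hf => isExpPoly_of_mem hinv (hsub hf)⟩
  · intro W H _ _ hW hH
    simp only [diffDistr_eq_pow] at hW hH
    obtain ⟨Z, hfin, hinv, hsub⟩ := exists_invariant_of_sub_one_pow coeDistr_injective
      continuous_coeDistr_translateDistrChar hm hdense hW hH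
    exact ⟨⟨Z, hfin, hinv, hsub⟩, fun T hT => isExpPolyDistr_of_mem hinv (hsub hT)⟩
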